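/- Let $n\ge 1$ and let $G=\langle r_0,\dots,r_{n-1}\rangle\subset GL(V)$ be the linear Coxeter group, in its standard representation on $V=\mathbb{R}^n$, of a string Coxeter diagram $[p_1,\dots,p_{n-1}]$ ($2\le p_j\le\infty$): with simple roots $\alpha_0,\dots,\alpha_{n-1}$ a basis of $V$ and the form $\alpha_i\cdot\alpha_j=-\cos(\pi/p_{ij})$, where $p_{ij}$ is the period of $r_ir_j$ in the Coxeter group ($p_{j-1,j}=p_j$, and $p_{ij}=2$ for $|i-j|\ge 2$; the value is $-1$ if $p_{ij}=\infty$), put $r_i(x)=x-2(\alpha_i\cdot x)\alpha_i$. Assume that $G$ is crystallographic and fix a basic system for it, that is, nonzero multiples $b_j$ of the $\alpha_j$ and integers $m_{ij}$ such that $r_i(b_j)=b_j+m_{ij}b_i$ for all $i,j$. In the basis $(b_j)$ the group $G$ becomes a subgroup of $GL_n(\mathbb{Z})$; for a subgroup $K\le G$ and $s\ge 2$ let $K^s\le GL_n(\mathbb{Z}/s)$ be its image under reduction modulo $s$. For $J\subseteq\{0,\dots,n-1\}$ let $G_J=\langle r_j : j\notin J\rangle$ and $V_J=\operatorname{span}_{\mathbb{R}}(b_j: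 j\notin J)$, and write $G_k=G_{\{k\}}$, $G_{k,l}=G_{\{k,l\}}$. A group generated by $\rho_0,\dots,\rho_{n-1}$ is a string C-group (with respect to these generators) if every $\rho_i$ has order exactly $2$, $(\rho_i\rho_j)^2=1$ whenever $|i-j|\ge 2$, and $\langle\rho_i : i\in I\rangle\cap\langle\rho_i : i\in J\rangle=\langle\rho_i : i\in I\cap J\rangle$ for all $I,J\subseteq\{0,\dots,n-1\}$. For $G^s$ the generators are the images of the $r_i$. $G_J$ is of spherical type if it is finite. It is of Euclidean type if the diagram on the nodes outside $J$ is connected and the form restricted to $V_J$ is positive semidefinite but not positive definite; its translation group $T$ then consists of those $g\in G_J$ with $g(x)-x\in\operatorname{rad}(V_J)$ for all $x\in V_J$, where $\operatorname{rad}(V_J)=\{x\in V_J: x\cdot y=0 \text{ for all } y\in V_J\}$. Theorem. Let $s,d\ge 2$ be integers with $s\mid d$, and suppose that $G^s$ is a string C-group. Suppose also that either (a) $G_{n-1}$ is of spherical type and reduction modulo $s$ is injective on $G_{n-1}$ (so $G_{n-1}\simeq G_{n-1}^s$); or (b) $G_{n-1}$ is of Euclidean type, it is the internal semidirect product $G_{n-1}=T\rtimes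 G_{0,n-1}$ of its translation group $T$ and the subgroup $G_{0,n-1}$, reduction modulo $s$ is injective on $G_{0,n-1}$ (so $G_{0,n-1}\simeq G_{0,n-1}^s$), and $T^d\cap\langle r_1,\dots,r_{n-1}\rangle^d=\{e\}$. Then $G^d$ is a string C-group. The dual statement holds as well: if $G^s$ is a string C-group and either (a$'$) $G_0$ is of spherical type and reduction modulo $s$ is injective on $G_0$, or (b$'$) $G_0$ is of Euclidean type with translation group $T$, $G_0=T\rtimes G_{0,n-1}$, reduction modulo $s$ is injective on $G_{0,n-1}$, and $T^d\cap\langle r_0,\dots,r_{n-2}\rangle^d=\{e\}$, then $G^d$ is a string C-group. -/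

import Mathlib

noncomputable section

/-! ### String C-groups -/

/-- The subgroup `Γ`, with the specified generators `ρ 0, …, ρ (n-1)`, is a string C-group:
it is generated by these elements, they are involutions, those with non-adjacent indices commute,
and the standard subgroups satisfy the intersection condition. -/
structure IsStringCGroup {A : Type*} [Group A] {n : ℕ} (Γ : Subgroup A) (ρ : Fin n → A) :
    Prop where
  generates : Subgroup.closure (Set.range ρ) = Γ
  involution : ∀ i, ρ i ≠ 1 ∧ ρ i ^ 2 = 1
  string : ∀ i j : Fin n, (i : ℕ) + 2 ≤ (j : ℕ) → (ρ i * ρ j) ^ 2 = 1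
  intersection : ∀ I J : Set (Fin n),
    Subgroup.closure (ρ '' I) ⊓ Subgroup.closure (ρ '' J) = Subgroup.closure (ρ '' (I ∩ J))

/-- `E` is the internal semidirect product `T ⋊ H` of its subgroups `T` (normal) and `H`. -/
structure IsInternalSemidirect {A : Type*} [Group A] (E T H : Subgroup A) : Prop where
  left_le : T ≤ E
  right_le : H ≤ E
  normal : (T.subgroupOf E).Normal
  disjoint : T ⊓ H = ⊥
  sup : T ⊔ H = E

/-! ### Linear Coxeter groups -/

/-- Reduction modulo `s`, as a homomorphism `GL_n(ℤ) → GL_n(ℤ/s)`. For a subgroup `K` of `G`, its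
modular image `K^s` is `K.map (modReduction s)`. -/
def modReduction {n : ℕ} (s : ℕ) : GL (Fin n) ℤ →* GL (Fin n) (ZMod s) :=
  Matrix.GeneralLinearGroup.map (Int.castRingHom (ZMod s))

namespace CoxeterMatrix

variable {n : ℕ}

/-- The Coxeter diagram is a string (possibly disconnected): `[p₁, …, pₙ₋₁]` with
`pⱼ = M (j-1) j`; an entry `0` stands for `∞`. -/
def IsString (M : CoxeterMatrix (Fin n)) : Prop :=
  ∀ i j : Fin n, (i : ℕ) + 2 ≤ (j : ℕ) → M i j = 2

/-- The Coxeter diagram as a graph: distinct nodes are joined unless `M i j = 2`. -/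
def diagram (M : CoxeterMatrix (Fin n)) : SimpleGraph (Fin n) :=
  SimpleGraph.fromRel fun i j => M i j ≠ 2

/-- The invariant symmetric bilinear form of the standard representation on `V = ℝⁿ`, with
`αᵢ · αⱼ = -cos (π / M i j)`. For `M i j = 0` (that is `∞`), Lean's `π / 0 = 0` gives the usual
value `-1`. -/
def stdForm (M : CoxeterMatrix (Fin n)) : LinearMap.BilinForm ℝ (Fin n → ℝ) :=
  Matrix.toBilin' (Matrix.of fun i j => -Real.cos (Real.pi / (M i j : ℝ)))

/-- The unit simple root `αᵢ`. -/
def simpleRoot (_M : CoxeterMatrix (Fin n)) (i : Fin n) : Fin n → ℝ := Pi.single i 1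

/-- The reflection `rᵢ(x) = x - 2 (αᵢ · x) αᵢ` of the standard representation. -/
def stdReflection (M : CoxeterMatrix (Fin n)) (i : Fin n) : (Fin n → ℝ) →ₗ[ℝ] (Fin n → ℝ) :=
  LinearMap.id - ((2 : ℝ) • M.stdForm (M.simpleRoot i)).smulRight (M.simpleRoot i)

/-- The subspace `V_J` of `V` spanned by the roots with index outside `J`. -/
def subspaceOmit (M : CoxeterMatrix (Fin n)) (J : Set (Fin n)) : Submodule ℝ (Fin n → ℝ) :=
  Submodule.span ℝ (M.simpleRoot '' Jᶜ)

/-- The radical of the form restricted to `V_J`. -/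
def radicalOmit (M : CoxeterMatrix (Fin n)) (J : Set (Fin n)) : Submodule ℝ (Fin n → ℝ) :=
  M.subspaceOmit J ⊓ M.stdForm.orthogonal (M.subspaceOmit J)

/-- The standard subgroup `G_J` on the nodes outside `J` is of Euclidean (affine) type: its diagram
is connected and the form on `V_J` is positive semidefinite but not positive definite. -/
structure IsEuclideanOmit (M : CoxeterMatrix (Fin n)) (J : Set (Fin n)) : Prop where
  connected : (M.diagram.induce Jᶜ).Connected
  semidefinite : ∀ x ∈ M.subspaceOmit J, 0 ≤ M.stdForm x x
  degenerate : ∃ x ∈ M.subspaceOmit J, x ≠ 0 ∧ M.stdForm x x = 0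

theorem stdForm_simpleRoot_self (M : CoxeterMatrix (Fin n)) (i : Fin n) :
    M.stdForm (M.simpleRoot i) (M.simpleRoot i) = 1 := by
  simp [stdForm, simpleRoot, Matrix.toBilin'_single]

/-- A basic system for the linear Coxeter group of `M`: nonzero multiples `bⱼ` of the simple roots
such that all reflections have integral matrices in the basis `b`; equivalently, the group leaves
the lattice `∑ ℤ bⱼ` invariant. The integers `m i j` are the Cartan integers. -/
structure BasicSystem (M : CoxeterMatrix (Fin n)) where
  scale : Fin n → ℝ
  scale_ne_zero : ∀ i, scale i ≠ 0
  m : Fin n → Fin n → ℤ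
  reflection_root : ∀ i j, M.stdReflection i (scale j • M.simpleRoot j) =
    scale j • M.simpleRoot j + (m i j : ℝ) • (scale i • M.simpleRoot i)

namespace BasicSystem

variable {M : CoxeterMatrix (Fin n)} (β : M.BasicSystem)

/-- The basis `b` of `V`, with `bⱼ = scale j • αⱼ`. -/
def basis : Module.Basis (Fin n) ℝ (Fin n → ℝ) :=
  (Pi.basisFun ℝ (Fin n)).isUnitSMul (w := β.scale) fun i => (β.scale_ne_zero i).isUnit

theorem basis_apply (i : Fin n) : β.basis i = β.scale i • M.simpleRoot i := by
  rw [basis, Module.Basis.isUnitSMul_apply, Pi.basisFun_apply, simpleRoot]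

theorem m_self (i : Fin n) : β.m i i = -2 := by
  have h := congrFun (β.reflection_root i i) i
  have h1 := M.stdForm_simpleRoot_self i
  have h2 := β.scale_ne_zero i
  simp only [stdReflection, LinearMap.sub_apply, LinearMap.id_apply, LinearMap.smulRight_apply,
    LinearMap.smul_apply, map_smul, h1] at h
  simp [simpleRoot] at h
  have h3 : ((β.m i i : ℤ) : ℝ) = -2 := by
    apply mul_right_cancel₀ h2
    linarith
  exact_mod_cast h3

/-- The integral matrix of `rᵢ` in the basis `b`, from `rᵢ(bⱼ) = bⱼ + m i j • bᵢ`. -/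
def genMatrix (i : Fin n) : Matrix (Fin n) (Fin n) ℤ :=
  1 + Matrix.of fun k j => if k = i then β.m i j else 0

theorem genMatrix_mul_self (i : Fin n) : β.genMatrix i * β.genMatrix i = 1 := by
  have h : (Matrix.of fun k j => if k = i then β.m i j else 0 : Matrix (Fin n) (Fin n) ℤ) *
      (Matrix.of fun k j => if k = i then β.m i j else 0) =
      (-2 : ℤ) • (Matrix.of fun k j => if k = i then β.m i j else 0) := by
    ext k j
    by_cases hk : k = i <;> simp [Matrix.mul_apply, hk, β.m_self]
  rw [genMatrix, mul_add, add_mul, add_mul, h]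
  simp only [mul_one, one_mul]
  module

/-- The generator `rᵢ`, written as an element of `GL_n(ℤ)` in the basis `b`. -/
def gen (i : Fin n) : GL (Fin n) ℤ :=
  ⟨β.genMatrix i, β.genMatrix i, β.genMatrix_mul_self i, β.genMatrix_mul_self i⟩

/-- The linear map of `V` whose matrix in the basis `b` is `g`. -/
def act : GL (Fin n) ℤ →* Module.End ℝ (Fin n → ℝ) :=
  ((Matrix.toLinAlgEquiv β.basis : Matrix (Fin n) (Fin n) ℝ →* Module.End ℝ (Fin n → ℝ)).comp
    ((Int.castRingHom ℝ).mapMatrix.toMonoidHom :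
      Matrix (Fin n) (Fin n) ℤ →* Matrix (Fin n) (Fin n) ℝ)).comp
    (Units.coeHom _)

/-- The integral matrix `gen i` represents the standard reflection `rᵢ`. -/
theorem act_gen (i : Fin n) : β.act (β.gen i) = M.stdReflection i := by
  refine β.basis.ext fun j => ?_
  rw [β.basis_apply j, β.reflection_root i j, ← β.basis_apply, ← β.basis_apply]
  have : β.act (β.gen i) (β.basis j) =
      Matrix.toLin β.basis β.basis ((β.genMatrix i).map (Int.cast : ℤ → ℝ)) (β.basis j) := rfl
  rw [this, Matrix.toLin_self]
  have h : ∀ k, ((β.genMatrix i).map (Int.cast : ℤ → ℝ)) k j • β.basis k =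
      (if k = j then β.basis k else 0) + (if k = i then (β.m i j : ℝ) • β.basis k else 0) := by
    intro k
    by_cases h1 : k = j <;> by_cases h2 : k = i <;>
      simp [genMatrix, Matrix.one_apply, h1, h2, add_smul]
  simp only [h, Finset.sum_add_distrib, Finset.sum_ite_eq', Finset.mem_univ, if_true]

/-- The standard subgroup `G_J = ⟨rⱼ | j ∉ J⟩` of the linear Coxeter group `G`, written as
integral matrices in the basis `b`. Thus `G = G_∅`. -/
def standardOmit (J : Set (Fin n)) : Subgroup (GL (Fin n) ℤ) :=
  Subgroup.closure (β.gen '' Jᶜ)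

/-- The linear Coxeter group `G = ⟨r₀, …, rₙ₋₁⟩`. -/
def group : Subgroup (GL (Fin n) ℤ) := Subgroup.closure (Set.range β.gen)

/-- The subgroup `T` of translations in `G_J`: the elements that act trivially on
`V_J / rad V_J`. When `G_J` is of Euclidean type, `rad V_J = ℝ c`, so these are the transvections
`t(x) = x - τ(x) c` of `V_J`, that is, the elements inducing translations on the Euclidean space
`{μ ∈ V_J^* | μ(c) = 1}`. -/
def translations (J : Set (Fin n)) : Subgroup (GL (Fin n) ℤ) where
  carrier := {g | g ∈ β.standardOmit J ∧
    ∀ x ∈ M.subspaceOmit J, β.act g x - x ∈ M.radicalOmit J}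
  one_mem' := ⟨one_mem _, fun x _ => by simp⟩
  mul_mem' := by
    rintro g h ⟨hg, hg'⟩ ⟨hh, hh'⟩
    refine ⟨mul_mem hg hh, fun x hx => ?_⟩
    have h1 := hh' x hx
    have h2 : β.act h x ∈ M.subspaceOmit J := by
      have := add_mem h1.1 hx
      simpa using this
    have h3 := add_mem (hg' _ h2) h1
    simpa [map_mul] using h3
  inv_mem' := by
    rintro g ⟨hg, hg'⟩
    refine ⟨inv_mem hg, fun x hx => ?_⟩
    have hinv : ∀ y, β.act g⁻¹ (β.act g y) = y := fun y => by
      rw [← Module.End.mul_apply, ← map_mul]; simp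
    have hmaps : ∀ y ∈ M.subspaceOmit J, β.act g y ∈ M.subspaceOmit J := fun y hy => by
      have := add_mem (hg' y hy).1 hy
      simpa using this
    have hinj : Function.Injective ((β.act g).restrict hmaps) := fun a b hab => by
      have h1 : β.act g a = β.act g b := congrArg Subtype.val hab
      have h2 := congrArg (β.act g⁻¹) h1
      rw [hinv, hinv] at h2
      exact Subtype.ext h2
    obtain ⟨y, hy⟩ := LinearMap.injective_iff_surjective.1 hinj ⟨x, hx⟩
    have hy' : β.act g y = x := congrArg Subtype.val hy
    have h4 := neg_mem (hg' y y.2)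
    rw [neg_sub, hy'] at h4
    rw [← hy', hinv, hy']
    exact h4

/-! ### The hypotheses on modular reductions -/

/-- `G^s`, with the images of the `rᵢ` as generators, is a string C-group. -/
def IsStringCGroupMod (s : ℕ) : Prop :=
  IsStringCGroup (β.group.map (modReduction s)) fun i => modReduction s (β.gen i)

/-- Case (a) for the node `k`: `G_k` is of spherical type (finite) and reduction modulo `s` is
faithful on it. -/
structure SphericalCondition (s : ℕ) (k : Fin n) : Prop where
  spherical : Finite (β.standardOmit {k})
  faithful : Set.InjOn (modReduction s) (β.standardOmit {k} : Set (GL (Fin n) ℤ))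

/-- Case (b) for the node `k`, with `l` the other end node: `G_k = T ⋊ G_{l,k}` is of Euclidean
type, with `T` its subgroup of translations, reduction modulo `s` is faithful on the point group
`G_{l,k}`, and `T^d ∩ G_l^d = {e}`. -/
structure EuclideanCondition (s d : ℕ) (k l : Fin n) : Prop where
  euclidean : M.IsEuclideanOmit {k}
  semidirect : IsInternalSemidirect (β.standardOmit {k}) (β.translations {k})
    (β.standardOmit {l, k})
  faithful : Set.InjOn (modReduction s) (β.standardOmit {l, k} : Set (GL (Fin n) ℤ))
  inter : (β.translations {k}).map (modReduction d) ⊓ (β.standardOmit {l}).map (modReduction d) = ⊥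

end BasicSystem

end CoxeterMatrix

end

/-!
Write `G_J` for the subgroup generated by the `ρ j` with `j ∉ J`. In a string group, an index `k`
missing from `I` cuts the subgroup generated by the `ρ i`, `i ∈ I`, into two commuting factors, and
the modular law strips one of them off an intersection with any subgroup that contains it. Doing
this from both ends of the string reduces the intersection property to the single intersection
`G_0 ∩ G_{n-1} = G_{0,n-1}` and to intersections in which one of the subgroups lies in `G_{0,n-1}`.
The latter lift from `G^s` to `G^d`, because reduction modulo `s` is faithful on `G_{0,n-1}` and
factors through reduction modulo `d`. The former is what the end conditions provide: in case (a) it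
lifts from `G^s` in the same way, and in case (b) the modular law applied to `G_{n-1} = T G_{0,n-1}`
leaves only `T^d ∩ G_0^d = 1`.
-/

theorem inf_sup_eq_of_le_normalizer {A : Type*} [Group A] {T H K : Subgroup A}
    (hT : H ≤ Subgroup.normalizer (T : Set A)) (hK : H ≤ K) : K ⊓ (T ⊔ H) = K ⊓ T ⊔ H := by
  refine le_antisymm (SetLike.coe_subset_coe.1 ?_)
    (sup_le (inf_le_inf_left K le_sup_left) (le_inf hK le_sup_right))
  rw [Subgroup.coe_inf, Subgroup.coe_mul_of_right_le_normalizer_left T H hT,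
    ← Subgroup.inf_mul_assoc K T H hK]
  exact Subgroup.mul_subset (SetLike.coe_subset_coe.2 le_sup_left)
    (SetLike.coe_subset_coe.2 le_sup_right)

theorem IsInternalSemidirect.map_inf_map_eq {A B : Type*} [Group A] [Group B]
    {E T H K : Subgroup A} (h : IsInternalSemidirect E T H) (hK : H ≤ K) {φ : A →* B}
    (hTK : T.map φ ⊓ K.map φ = ⊥) : K.map φ ⊓ E.map φ = H.map φ := by
  have hT : H ≤ Subgroup.normalizer (T : Set A) :=
    h.right_le.trans ((Subgroup.normal_subgroupOf_iff_le_normalizer h.left_le).1 h.normal)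
  rw [← h.sup, Subgroup.map_sup, inf_sup_eq_of_le_normalizer
    ((Subgroup.map_mono hT).trans (Subgroup.le_normalizer_map φ)) (Subgroup.map_mono hK),
    inf_comm, hTK, bot_sup_eq]

section StandardSubgroups

open Set

variable {ι A B C : Type*} [Group A] [Group B] [Group C]

/-- The standard subgroup `⟨ρ i | i ∈ I⟩` of the group generated by a family `ρ`. It is indexed by
the generators that are kept, so the subgroup `G_J` of the paper is `standardSubgroup ρ Jᶜ`. -/
def standardSubgroup (ρ : ι → A) (I : Set ι) : Subgroup A :=
  Subgroup.closure (ρ '' I)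

/-- The intersection property of C-groups: standard subgroups intersect like their index sets. -/
def IntersectionProperty (ρ : ι → A) : Prop :=
  ∀ I J : Set ι, standardSubgroup ρ I ⊓ standardSubgroup ρ J = standardSubgroup ρ (I ∩ J)

theorem standardSubgroup_mono (ρ : ι → A) {I J : Set ι} (h : I ⊆ J) :
    standardSubgroup ρ I ≤ standardSubgroup ρ J :=
  Subgroup.closure_mono (image_mono h)

theorem standardSubgroup_union (ρ : ι → A) (I J : Set ι) :
    standardSubgroup ρ (I ∪ J) = standardSubgroup ρ I ⊔ standardSubgroup ρ J := by
  rw [standardSubgroup, image_union, Subgroup.closure_union, standardSubgroup, standardSubgroup]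

theorem map_standardSubgroup (φ : A →* B) (ρ : ι → A) (I : Set ι) :
    (standardSubgroup ρ I).map φ = standardSubgroup (φ ∘ ρ) I := by
  rw [standardSubgroup, standardSubgroup, MonoidHom.map_closure, image_comp]

theorem standardSubgroup_le_centralizer {ρ : ι → A} {I J : Set ι}
    (h : ∀ i ∈ I, ∀ j ∈ J, Commute (ρ i) (ρ j)) :
    standardSubgroup ρ I ≤ Subgroup.centralizer (standardSubgroup ρ J : Set A) := by
  rw [standardSubgroup, standardSubgroup, Subgroup.centralizer_closure, Subgroup.closure_le]
  rintro _ ⟨i, hi, rfl⟩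
  refine Subgroup.mem_centralizer_iff.2 ?_
  rintro _ ⟨j, hj, rfl⟩
  exact (h i hi j hj).symm

theorem standardSubgroup_inf_union {ρ : ι → A} {I J K : Set ι}
    (h : ∀ k ∈ K, ∀ j ∈ J, Commute (ρ k) (ρ j)) (hKI : K ⊆ I) :
    standardSubgroup ρ I ⊓ standardSubgroup ρ (J ∪ K) =
      standardSubgroup ρ I ⊓ standardSubgroup ρ J ⊔ standardSubgroup ρ K := by
  rw [standardSubgroup_union]
  exact inf_sup_eq_of_le_normalizer
    ((standardSubgroup_le_centralizer h).trans (Subgroup.centralizer_le_normalizer _))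
    (standardSubgroup_mono ρ hKI)

theorem map_inf_map_le_of_injOn {ρ : ι → A} {σ : A →* B} {τ : A →* C} (hker : σ.ker ≤ τ.ker)
    (hτ : IntersectionProperty (τ ∘ ρ)) (I : Set ι) {J : Set ι}
    (hJ : InjOn τ (standardSubgroup ρ J : Set A)) :
    (standardSubgroup ρ I).map σ ⊓ (standardSubgroup ρ J).map σ ≤
      (standardSubgroup ρ (I ∩ J)).map σ := by
  rintro _ ⟨⟨a, ha, rfl⟩, b, hb, hba⟩
  have hτba : τ b = τ a := by
    rw [MonoidHom.eq_iff] at hba ⊢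
    exact hker hba
  have hτb : τ b ∈ (standardSubgroup ρ (I ∩ J)).map τ := by
    rw [map_standardSubgroup, ← hτ I J, ← map_standardSubgroup, ← map_standardSubgroup]
    exact ⟨⟨a, ha, hτba.symm⟩, b, hb, rfl⟩
  obtain ⟨c, hc, hcb⟩ := hτb
  have hcb' : c = b := hJ (standardSubgroup_mono ρ inter_subset_right hc) hb hcb
  exact ⟨c, hc, hcb' ▸ hba⟩

/-- The condition on a pair of nodes `k`, `l` under which the intersection property lifts from the
image of `τ` to the image of `σ`: the `σ`-images of `G_k` and `G_l` meet in that of `G_{k,l}`, and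
`τ` is faithful on `G_{k,l}`. For `σ` and `τ` the reductions modulo `d` and `s`, this is the common
content of the cases (a) and (b). -/
structure IsFaithfulMeet (σ : A →* B) (τ : A →* C) (ρ : ι → A) (k l : ι) : Prop where
  injOn : InjOn τ (standardSubgroup ρ {k, l}ᶜ : Set A)
  map_inf_map_le : (standardSubgroup ρ {k}ᶜ).map σ ⊓ (standardSubgroup ρ {l}ᶜ).map σ ≤
    (standardSubgroup ρ {k, l}ᶜ).map σ

namespace IsFaithfulMeet

variable {ρ : ι → A} {σ : A →* B} {τ : A →* C} {k l : ι}

theorem symm (h : IsFaithfulMeet σ τ ρ k l) : IsFaithfulMeet σ τ ρ l k where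
  injOn := pair_comm k l ▸ h.injOn
  map_inf_map_le := by
    rw [inf_comm, pair_comm]
    exact h.map_inf_map_le

theorem of_injOn (hker : σ.ker ≤ τ.ker) (hτ : IntersectionProperty (τ ∘ ρ)) (k : ι)
    (hl : InjOn τ (standardSubgroup ρ {l}ᶜ : Set A)) : IsFaithfulMeet σ τ ρ k l where
  injOn := hl.mono (standardSubgroup_mono ρ (compl_subset_compl.2 (subset_insert k {l})))
  map_inf_map_le := by
    have h := map_inf_map_le_of_injOn hker hτ {k}ᶜ hl
    rwa [← compl_union, singleton_union] at h

theorem of_isInternalSemidirect {T : Subgroup A}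
    (h : IsInternalSemidirect (standardSubgroup ρ {l}ᶜ) T (standardSubgroup ρ {k, l}ᶜ))
    (hinj : InjOn τ (standardSubgroup ρ {k, l}ᶜ : Set A))
    (hT : T.map σ ⊓ (standardSubgroup ρ {k}ᶜ).map σ = ⊥) : IsFaithfulMeet σ τ ρ k l where
  injOn := hinj
  map_inf_map_le := (h.map_inf_map_eq
    (standardSubgroup_mono ρ (compl_subset_compl.2 (by simp))) hT).le

end IsFaithfulMeet

end StandardSubgroups

section StringCommute

open Set OrderDual

variable {ι A B : Type*} [LinearOrder ι] [Group A] [Group B]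

/-- The commutation relations of a string diagram: generators with non-adjacent indices commute.
Non-adjacency is expressed by an intermediate index, which makes the notion self-dual. -/
def StringCommute (ρ : ι → A) : Prop :=
  ∀ ⦃i k j : ι⦄, i < k → k < j → Commute (ρ i) (ρ j)

namespace StringCommute

variable {ρ : ι → A}

theorem dual (hρ : StringCommute ρ) : StringCommute (ρ ∘ ofDual : ιᵒᵈ → A) :=
  fun _ _ _ hik hkj => (hρ hkj hik).symm

theorem map (hρ : StringCommute ρ) (φ : A →* B) : StringCommute (φ ∘ ρ) :=
  fun _ _ _ hik hkj => (hρ hik hkj).map φ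

theorem inf_eq_inf_Iio_sup (hρ : StringCommute ρ) {I J : Set ι} {k : ι} (hk : k ∉ J)
    (hI : J ∩ Ioi k ⊆ I) :
    standardSubgroup ρ I ⊓ standardSubgroup ρ J =
      standardSubgroup ρ I ⊓ standardSubgroup ρ (J ∩ Iio k) ⊔ standardSubgroup ρ (J ∩ Ioi k) := by
  have hJ : J ∩ Iio k ∪ J ∩ Ioi k = J := by
    rw [← inter_union_distrib_left, Iio_union_Ioi, inter_eq_left]
    exact subset_compl_singleton_iff.2 hk
  rw [← standardSubgroup_inf_union (fun j hj i hi => (hρ hi.2 hj.2).symm) hI, hJ]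

theorem inf_eq_inf_Ioi_sup (hρ : StringCommute ρ) {I J : Set ι} {k : ι} (hk : k ∉ J)
    (hI : J ∩ Iio k ⊆ I) :
    standardSubgroup ρ I ⊓ standardSubgroup ρ J =
      standardSubgroup ρ I ⊓ standardSubgroup ρ (J ∩ Ioi k) ⊔ standardSubgroup ρ (J ∩ Iio k) :=
  hρ.dual.inf_eq_inf_Iio_sup (k := toDual k) hk hI

theorem inf_le_of_diff_top [Finite ι] [OrderTop ι] (hρ : StringCommute ρ) {I J : Set ι}
    (hI : I ≠ univ) (hJ : J ≠ univ)
    (hIJ : standardSubgroup ρ I ⊓ standardSubgroup ρ (J \ {⊤}) ≤ standardSubgroup ρ (I ∩ J))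
    (hJI : standardSubgroup ρ J ⊓ standardSubgroup ρ (I \ {⊤}) ≤ standardSubgroup ρ (J ∩ I)) :
    standardSubgroup ρ I ⊓ standardSubgroup ρ J ≤ standardSubgroup ρ (I ∩ J) := by
  have exists_last_gap {K : Set ι} (hK : K ≠ univ) : ∃ k ∉ K, Ioi k ⊆ K := by
    obtain ⟨k, hk⟩ := (toFinite Kᶜ).exists_maximal (nonempty_compl.2 hK)
    exact ⟨k, hk.prop, fun j hj => not_not.1 fun hjK => hk.not_gt hjK hj⟩
  obtain ⟨k, hkI, hk⟩ := exists_last_gap hI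
  obtain ⟨l, hlJ, hl⟩ := exists_last_gap hJ
  wlog hkl : k ≤ l generalizing I J k l
  · rw [inf_comm, inter_comm]
    exact this hJ hI hJI hIJ l hlJ hl k hkI hk (le_of_not_ge hkl)
  have htail : J ∩ Ioi l ⊆ I := inter_subset_right.trans ((Ioi_subset_Ioi hkl).trans hk)
  have hhead : J ∩ Iio l ⊆ J \ {⊤} := fun j hj => ⟨hj.1, ne_top_of_lt hj.2⟩
  rw [hρ.inf_eq_inf_Iio_sup hlJ htail]
  exact sup_le ((inf_le_inf_left _ (standardSubgroup_mono ρ hhead)).trans hIJ)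
    (standardSubgroup_mono ρ (subset_inter htail inter_subset_left))

theorem inf_le_of_diff_bot [Finite ι] [OrderBot ι] (hρ : StringCommute ρ) {I J : Set ι}
    (hI : I ≠ univ) (hJ : J ≠ univ)
    (hIJ : standardSubgroup ρ I ⊓ standardSubgroup ρ (J \ {⊥}) ≤ standardSubgroup ρ (I ∩ J))
    (hJI : standardSubgroup ρ J ⊓ standardSubgroup ρ (I \ {⊥}) ≤ standardSubgroup ρ (J ∩ I)) :
    standardSubgroup ρ I ⊓ standardSubgroup ρ J ≤ standardSubgroup ρ (I ∩ J) :=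
  hρ.dual.inf_le_of_diff_top hI hJ hIJ hJI

theorem inf_compl_top_le [BoundedOrder ι] (hρ : StringCommute ρ)
    (hends : standardSubgroup ρ {⊥}ᶜ ⊓ standardSubgroup ρ {⊤}ᶜ ≤ standardSubgroup ρ {⊥, ⊤}ᶜ)
    (hmid : ∀ I J : Set ι, J ⊆ {⊥, ⊤}ᶜ →
      standardSubgroup ρ I ⊓ standardSubgroup ρ J ≤ standardSubgroup ρ (I ∩ J))
    {I : Set ι} (hI : I ≠ univ) :
    standardSubgroup ρ I ⊓ standardSubgroup ρ {⊤}ᶜ ≤ standardSubgroup ρ (I \ {⊤}) := by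
  obtain ⟨k, hk⟩ := (ne_univ_iff_exists_notMem I).1 hI
  have hhead : I ∩ Iio k ⊆ {⊤}ᶜ := fun i hi => ne_top_of_lt hi.2
  have htail : I ∩ Ioi k ⊆ {⊥}ᶜ := fun i hi => ne_bot_of_gt hi.2
  have htail_inf : standardSubgroup ρ {⊤}ᶜ ⊓ standardSubgroup ρ (I ∩ Ioi k) ≤
      standardSubgroup ρ (I \ {⊤}) :=
    calc standardSubgroup ρ {⊤}ᶜ ⊓ standardSubgroup ρ (I ∩ Ioi k)
      _ ≤ standardSubgroup ρ (I ∩ Ioi k) ⊓ standardSubgroup ρ {⊥, ⊤}ᶜ :=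
        le_inf inf_le_right <| le_trans
          (le_inf (inf_le_right.trans (standardSubgroup_mono ρ htail)) inf_le_left) hends
      _ ≤ standardSubgroup ρ ((I ∩ Ioi k) ∩ {⊥, ⊤}ᶜ) := hmid _ _ subset_rfl
      _ ≤ standardSubgroup ρ (I \ {⊤}) :=
        standardSubgroup_mono ρ fun i hi => ⟨hi.1.1, fun h => hi.2 (mem_insert_of_mem _ h)⟩
  rw [inf_comm, hρ.inf_eq_inf_Ioi_sup hk hhead]
  exact sup_le htail_inf (standardSubgroup_mono ρ fun i hi => ⟨hi.1, hhead hi⟩)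

theorem intersectionProperty [Finite ι] [BoundedOrder ι] (hρ : StringCommute ρ)
    (hends : standardSubgroup ρ {⊥}ᶜ ⊓ standardSubgroup ρ {⊤}ᶜ ≤ standardSubgroup ρ {⊥, ⊤}ᶜ)
    (hmid : ∀ I J : Set ι, J ⊆ {⊥, ⊤}ᶜ →
      standardSubgroup ρ I ⊓ standardSubgroup ρ J ≤ standardSubgroup ρ (I ∩ J)) :
    IntersectionProperty ρ := by
  have inf_le_of_top_notMem {I J : Set ι} (hI : ⊤ ∉ I) (hJ : ⊤ ∉ J) :
      standardSubgroup ρ I ⊓ standardSubgroup ρ J ≤ standardSubgroup ρ (I ∩ J) := by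
    have hdiff {K : Set ι} (hK : ⊤ ∉ K) : K \ {⊥} ⊆ {⊥, ⊤}ᶜ := by
      rintro i ⟨hi, hi₀⟩ (h | h)
      exacts [hi₀ h, hK (mem_singleton_iff.1 h ▸ hi)]
    refine hρ.inf_le_of_diff_bot ((ne_univ_iff_exists_notMem I).2 ⟨⊤, hI⟩)
      ((ne_univ_iff_exists_notMem J).2 ⟨⊤, hJ⟩) ?_ ?_
    · exact (hmid I _ (hdiff hJ)).trans
        (standardSubgroup_mono ρ (inter_subset_inter_right I sdiff_subset))
    · exact (hmid J _ (hdiff hI)).trans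
        (standardSubgroup_mono ρ (inter_subset_inter_right J sdiff_subset))
  have inf_diff_top_le {I : Set ι} (hI : I ≠ univ) (J : Set ι) :
      standardSubgroup ρ I ⊓ standardSubgroup ρ (J \ {⊤}) ≤ standardSubgroup ρ (I ∩ J) :=
    calc standardSubgroup ρ I ⊓ standardSubgroup ρ (J \ {⊤})
      _ ≤ standardSubgroup ρ (I \ {⊤}) ⊓ standardSubgroup ρ (J \ {⊤}) :=
        le_inf ((inf_le_inf_left _ (standardSubgroup_mono ρ fun _ hj => hj.2)).trans
          (hρ.inf_compl_top_le hends hmid hI)) inf_le_right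
      _ ≤ standardSubgroup ρ (I \ {⊤} ∩ (J \ {⊤})) :=
        inf_le_of_top_notMem (fun h => h.2 rfl) (fun h => h.2 rfl)
      _ ≤ standardSubgroup ρ (I ∩ J) :=
        standardSubgroup_mono ρ (inter_subset_inter sdiff_subset sdiff_subset)
  intro I J
  refine le_antisymm ?_ (le_inf (standardSubgroup_mono ρ inter_subset_left)
    (standardSubgroup_mono ρ inter_subset_right))
  rcases eq_or_ne I univ with rfl | hI
  · rw [univ_inter]
    exact inf_le_right
  rcases eq_or_ne J univ with rfl | hJ
  · rw [inter_univ]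
    exact inf_le_left
  exact hρ.inf_le_of_diff_top hI hJ (inf_diff_top_le hI J) (inf_diff_top_le hJ I)

end StringCommute

end StringCommute

theorem IsFaithfulMeet.intersectionProperty {ι A B C : Type*} [LinearOrder ι] [Finite ι]
    [BoundedOrder ι] [Group A] [Group B] [Group C] {ρ : ι → A} {σ : A →* B} {τ : A →* C}
    (h : IsFaithfulMeet σ τ ρ ⊥ ⊤) (hρ : StringCommute (σ ∘ ρ)) (hker : σ.ker ≤ τ.ker)
    (hτ : IntersectionProperty (τ ∘ ρ)) : IntersectionProperty (σ ∘ ρ) := by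
  refine hρ.intersectionProperty ?_ fun I J hJ => ?_
  · simpa only [map_standardSubgroup] using h.map_inf_map_le
  · simpa only [map_standardSubgroup] using
      map_inf_map_le_of_injOn hker hτ I (h.injOn.mono (standardSubgroup_mono ρ hJ))

/-- `σ` and `τ` stand for the reductions modulo `d` and `s`, and `σ.ker ≤ τ.ker` for `s ∣ d`. -/
theorem theorem1_general {A B C : Type*} [Group A] [Group B] [Group C] {n : ℕ}
    {ρ : Fin (n + 1) → A} (hsq : ∀ i, ρ i ^ 2 = 1) (hρ : StringCommute ρ) {σ : A →* B} {τ : A →* C}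
    (hker : σ.ker ≤ τ.ker)
    (hτ : IsStringCGroup ((Subgroup.closure (Set.range ρ)).map τ) (τ ∘ ρ))
    (hends : IsFaithfulMeet σ τ ρ 0 (Fin.last n)) :
    IsStringCGroup ((Subgroup.closure (Set.range ρ)).map σ) (σ ∘ ρ) where
  generates := by rw [MonoidHom.map_closure, Set.range_comp]
  involution i := by
    refine ⟨fun hi => (hτ.involution i).1 (hker hi), ?_⟩
    rw [Function.comp_apply, ← map_pow, hsq, map_one]
  string i j hij := by
    have hcomm : Commute (ρ i) (ρ j) :=
      hρ (k := ⟨i + 1, by omega⟩) (Fin.lt_def.2 (Nat.lt_succ_self i)) (Fin.lt_def.2 hij)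
    rw [Function.comp_apply, Function.comp_apply, ← map_mul, ← map_pow, hcomm.mul_pow, hsq, hsq,
      one_mul, map_one]
  intersection := hends.intersectionProperty (hρ.map σ) hker hτ.intersection

theorem ker_modReduction_le {n s d : ℕ} (h : s ∣ d) :
    (modReduction d : GL (Fin n) ℤ →* _).ker ≤ (modReduction s).ker := by
  have hcast : Int.castRingHom (ZMod s) =
      (ZMod.castHom h (ZMod s)).comp (Int.castRingHom (ZMod d)) := RingHom.ext_int _ _
  rw [modReduction, modReduction, hcast, Matrix.GeneralLinearGroup.map_comp, ← MonoidHom.comap_ker]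
  exact Subgroup.comap_mono bot_le

namespace CoxeterMatrix.BasicSystem

variable {n : ℕ} {M : CoxeterMatrix (Fin n)} (β : M.BasicSystem)

theorem gen_sq (i : Fin n) : β.gen i ^ 2 = 1 := by
  rw [sq]
  exact Units.ext (β.genMatrix_mul_self i)

theorem m_eq_zero {i j : Fin n} (h : M i j = 2) : β.m i j = 0 := by
  have horthogonal : M.stdForm (M.simpleRoot i) (M.simpleRoot j) = 0 := by
    simp [stdForm, simpleRoot, Matrix.toBilin'_single, h]
  have hfixed : M.stdReflection i (β.scale j • M.simpleRoot j) = β.scale j • M.simpleRoot j := by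
    simp [stdReflection, horthogonal]
  have hroot : (β.m i j : ℝ) • (β.scale i • M.simpleRoot i) = 0 :=
    left_eq_add.1 (hfixed.symm.trans (β.reflection_root i j))
  simpa [simpleRoot, β.scale_ne_zero i] using congrFun hroot i

theorem gen_commute {i j : Fin n} (h : M i j = 2) : Commute (β.gen i) (β.gen j) := by
  have hmul {a b : Fin n} (hab : β.m a b = 0) :
      (Matrix.of fun k l => if k = a then β.m a l else 0 : Matrix (Fin n) (Fin n) ℤ) *
        (Matrix.of fun k l => if k = b then β.m b l else 0) = 0 := by
    ext k l
    simp [Matrix.mul_apply, hab]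
  refine Units.ext ?_
  change β.genMatrix i * β.genMatrix j = β.genMatrix j * β.genMatrix i
  simp only [genMatrix, mul_add, add_mul, one_mul, mul_one, hmul (β.m_eq_zero h),
    hmul (β.m_eq_zero ((M.symmetric j i).trans h))]
  abel

theorem stringCommute_gen (hM : M.IsString) : StringCommute β.gen :=
  fun i _ j hik hkj => β.gen_commute (hM i j (by omega))

theorem isFaithfulMeet_gen {s d : ℕ} (hsd : s ∣ d) (hG : β.IsStringCGroupMod s)
    {k l : Fin n} (h : β.SphericalCondition s k ∨ β.EuclideanCondition s d k l) :
    IsFaithfulMeet (modReduction d) (modReduction s) β.gen l k := by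
  rcases h with h | h
  · exact .of_injOn (ker_modReduction_le hsd) hG.intersection l h.faithful
  · exact .of_isInternalSemidirect h.semidirect h.faithful h.inter

end CoxeterMatrix.BasicSystem

theorem theorem1 {n : ℕ} (M : CoxeterMatrix (Fin (n + 1))) (hM : M.IsString)
    (β : M.BasicSystem) (s d : ℕ) (hs : 2 ≤ s) (hd : 2 ≤ d) (hsd : s ∣ d)
    (hG : β.IsStringCGroupMod s) :
    (β.SphericalCondition s (Fin.last n) ∨ β.EuclideanCondition s d (Fin.last n) 0 →
      β.IsStringCGroupMod d) ∧
    (β.SphericalCondition s 0 ∨ β.EuclideanCondition s d 0 (Fin.last n) →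
      β.IsStringCGroupMod d) := by
  have lift := theorem1_general β.gen_sq (β.stringCommute_gen hM) (ker_modReduction_le hsd) hG
  exact ⟨fun h => lift (β.isFaithfulMeet_gen hsd hG h),
    fun h => lift (β.isFaithfulMeet_gen hsd hG h).symm⟩
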